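/- Let $\mathcal I$ be a nonzero ideal of $\mathbb C[[x,y]]$ and let $\overline{\mathcal I}$ be its integral closure, i.e. the ideal of all $r$ satisfying $r^n+a_1r^{n-1}+\dots+a_n=0$ for some $n\ge 1$ and $a_i\in\mathcal I^i$. Then $\overline{\mathcal I}$ and $\mathcal I$ have the same Newton process. Here the Newton process is defined as follows. *Faces.* The Newton diagram $\Delta(\mathcal I)\subset\mathbb R^2$ is the convex hull of $\bigcup_{f\in\mathcal I}\operatorname{Supp} f+\mathbb R_{\ge0}^2$, where $\operatorname{Supp} f\subset\mathbb N^2$ is the set of exponents $(\alpha,\beta)$ of the monomials $x^\alpha y^\beta$ occurring in $f$. A face $S$ of $\mathcal I$ is a one-dimensional compact face of $\Delta(\mathcal I)$; its supporting line has an equation $p\alpha+q\beta=N$ with $p,q\ge1$ coprime integers and $N\in\mathbb N$. The initial ideal $\operatorname{in}(\mathcal I,S)\subset\mathbb C[x,y]$ is generated by the parts $\sum_{p\alpha+q\beta=N}c_{\alpha,\beta}x^\alpha y^\beta$ of the elements $f=\sum c_{\alpha,\beta}x^\alpha y^\beta$ of $\mathcal I$. It can be written $$\operatorname{in}(\mathcal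 I,S)=x^{a}y^{b}F(x^{q},y^{p})\,\bigl(k_1(x^{q},y^{p}),\dots,k_s(x^{q},y^{p})\bigr),$$ with $F$ homogeneous, monic in $y$ and not divisible by $x$ or $y$, and $k_1,\dots,k_s$ coprime homogeneous polynomials of the same degree $d$. Then $F$ (the face polynomial $F_{\mathcal I,S}$) and $d$ (the degree $d_S$) are uniquely determined, and $S$ is called dicritical if $d_S\ge 1$. *Newton maps.* For coprime $p,q\ge 1$ and $\mu\in\mathbb C^*$, let $(p',q')\in\mathbb N^2$ be the unique pair with $pp'-qq'=1$, $p'\le q$, $q'<p$. The Newton map $\sigma_{(p,q,\mu)}:\mathbb C[[x,y]]\to\mathbb C[[x,y]]$ is $f(x,y)\mapsto f\bigl(\mu^{q'}x^p,\;x^q(y+\mu^{p'})\bigr)$, and $\mathcal I_\sigma$ denotes the ideal generated by $\sigma(\mathcal I)$. For $\Sigma=(\sigma_1,\dots,\sigma_j)$, $j\ge 0$, put $\mathcal I_\Sigma=(\cdots(\mathcal I_{\sigma_1})\cdots)_{\sigma_j}$. *Algorithm.* An ideal has depth $0$ if it is generated by $x^k(y+h(x))^\nu$ for some $k,\nu\in\mathbb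 N$ and $h\in x\mathbb C[[x]]$. A sequence $\Sigma=(\sigma_1,\dots,\sigma_j)$ of Newton maps occurs in the Newton algorithm of $\mathcal I$ if, for every $i$, the ideal $\mathcal J=\mathcal I_{(\sigma_1,\dots,\sigma_{i-1})}$ does not have depth $0$ and $\sigma_i=\sigma_{(p,q,\mu)}$, where $p\alpha+q\beta=N$ is the supporting line of a face $S$ of $\mathcal J$ and $\mu$ is a root of $F_{\mathcal J,S}(1,X)$. *Newton process.* The Newton process of $\mathcal I$ consists of the largest $k$ such that $x^k$ divides $\mathcal I$ and of the set of the following elements, where $\Sigma$ runs through the sequences (including the empty one) occurring in the Newton algorithm of $\mathcal I$: 1. if $\mathcal I_\Sigma$ does not have depth $0$: the element $(\Sigma,\sigma_{(p,q,\mu)};d_S)$ with $\mu$ a generic symbol, for every dicritical face $S$ of $\mathcal I_\Sigma$, with supporting line $p\alpha+q\beta=N$; 2. if $\mathcal I_\Sigma=\bigl(x^k(y+h(x))^\nu\bigr)$ with $h\in x\mathbb C[[x]]$ and $\nu\ge1$: the element $(\Sigma;(y+h(x))^\nu)$; 3. if $\mathcal I_\Sigma$ does not have depth $0$ and is divisible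 by $y$: the element $(\Sigma;y^{b})$, where $y^b$ is the largest power of $y$ dividing $\mathcal I_\Sigma$. -/

import Mathlib

namespace NewtonAlg

/-! ### Integral closure of an ideal -/

section IntegralClosure

variable {R : Type*} [CommRing R]

/-- `r` is integral over the ideal `I`: it satisfies an equation
`r ^ n + a₁ r ^ (n - 1) + ⋯ + aₙ = 0` with `n ≥ 1` and `aᵢ ∈ I ^ i`. -/
def IsIntegralOver (I : Ideal R) (r : R) : Prop :=
  ∃ n : ℕ, 0 < n ∧ ∃ a : ℕ → R, (∀ i, a i ∈ I ^ i) ∧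
    r ^ n + ∑ i ∈ Finset.Icc 1 n, a i * r ^ (n - i) = 0

theorem isIntegralOver_iff_rees [Nontrivial R] (I : Ideal R) (r : R) :
    IsIntegralOver I r ↔ IsIntegral (reesAlgebra I) (Polynomial.monomial 1 r) := by
  constructor
  · rintro ⟨n, hn, a, ha, h⟩
    let c : ℕ → reesAlgebra I := fun i => ⟨Polynomial.monomial i (a i),
      reesAlgebra.monomial_mem.2 (ha i)⟩
    refine ⟨Polynomial.X ^ n + ∑ i ∈ Finset.Icc 1 n,
      Polynomial.C (c i) * Polynomial.X ^ (n - i), ?_, ?_⟩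
    · apply Polynomial.monic_X_pow_add
      refine (Polynomial.degree_sum_le _ _).trans_lt ?_
      rw [Finset.sup_lt_iff (by simp)]
      intro i hi
      rw [Finset.mem_Icc] at hi
      refine (Polynomial.degree_C_mul_X_pow_le _ _).trans_lt ?_
      exact_mod_cast (by omega : n - i < n)
    · have key : ∀ i ∈ Finset.Icc 1 n,
          (Polynomial.monomial i (a i) : Polynomial R) * Polynomial.monomial (n - i) (r ^ (n - i))
            = Polynomial.monomial n (a i * r ^ (n - i)) := by
        intro i hi
        rw [Finset.mem_Icc] at hi
        rw [Polynomial.monomial_mul_monomial]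
        congr 2
        omega
      have hc : ∀ i, algebraMap (reesAlgebra I) (Polynomial R) (c i)
          = Polynomial.monomial i (a i) := fun i => rfl
      simp only [Polynomial.eval₂_add, Polynomial.eval₂_pow, Polynomial.eval₂_X,
        Polynomial.eval₂_finsetSum, Polynomial.eval₂_mul, Polynomial.eval₂_C, hc,
        Polynomial.monomial_pow, one_mul]
      rw [Finset.sum_congr rfl key, ← map_sum, ← map_add, h, map_zero]
  · rintro ⟨P, hP, h⟩
    have hb : ∀ j : ℕ, ∀ i, ((P.coeff j : reesAlgebra I) : Polynomial R).coeff i ∈ I ^ i :=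
      fun j i => (P.coeff j).2 i
    have hdeg : 0 < P.natDegree := by
      rcases Nat.eq_zero_or_pos P.natDegree with h0 | h0
      · rw [hP.natDegree_eq_zero.1 h0] at h
        simp at h
      · exact h0
    set n := P.natDegree with hn
    refine ⟨n, hdeg, fun i => if i ≤ n then
      ((P.coeff (n - i) : reesAlgebra I) : Polynomial R).coeff i else 0, ?_, ?_⟩
    · intro i
      dsimp only
      split_ifs
      · exact hb _ _
      · exact zero_mem _
    · rw [Polynomial.eval₂_eq_sum_range] at h
      have h' := congrArg (fun Q : Polynomial R => Q.coeff n) h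
      simp only [Polynomial.finsetSum_coeff, Polynomial.coeff_zero, Polynomial.monomial_pow,
        one_mul] at h'
      rw [← hn] at h'
      have hterm : ∀ j ∈ Finset.range (n + 1),
          ((algebraMap (reesAlgebra I) (Polynomial R)) (P.coeff j) *
            Polynomial.monomial j (r ^ j)).coeff n =
          ((P.coeff j : reesAlgebra I) : Polynomial R).coeff (n - j) * r ^ j := by
        intro j hj
        rw [Finset.mem_range] at hj
        have := Polynomial.coeff_mul_monomial
          ((algebraMap (reesAlgebra I) (Polynomial R)) (P.coeff j)) j (n - j) (r ^ j)
        rw [Nat.sub_add_cancel (by omega)] at this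
        exact this
      rw [Finset.sum_congr rfl hterm, Finset.sum_range_succ] at h'
      have hlead : P.coeff n = 1 := hP
      rw [hlead] at h'
      simp only [OneMemClass.coe_one, Nat.sub_self, Polynomial.coeff_one_zero, one_mul] at h'
      refine Eq.trans ?_ h'
      rw [add_comm]
      congr 1
      refine Finset.sum_bij' (fun i _ => n - i) (fun j _ => n - j) ?_ ?_ ?_ ?_ ?_
      · intro i hi; simp only [Finset.mem_Icc, Finset.mem_range] at *; omega
      · intro i hi; simp only [Finset.mem_Icc, Finset.mem_range] at *; omega
      · intro i hi; simp only [Finset.mem_Icc] at *; omega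
      · intro i hi; simp only [Finset.mem_range] at *; omega
      · intro i hi
        simp only [Finset.mem_Icc] at hi
        simp only [if_pos hi.2, Nat.sub_sub_self hi.2]

/-- The integral closure of an ideal: the ideal of all elements integral over it. -/
def integralClosure [Nontrivial R] (I : Ideal R) : Ideal R where
  carrier := {r | IsIntegralOver I r}
  zero_mem' := by
    rw [Set.mem_ofPred_eq, isIntegralOver_iff_rees, map_zero]
    exact isIntegral_zero
  add_mem' := by
    intro a b ha hb
    rw [Set.mem_ofPred_eq, isIntegralOver_iff_rees] at *
    rw [map_add]
    exact ha.add hb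
  smul_mem' := by
    intro c a ha
    rw [Set.mem_ofPred_eq, isIntegralOver_iff_rees] at *
    have h : (Polynomial.monomial 1 (c • a) : Polynomial R) =
        algebraMap (reesAlgebra I) (Polynomial R) (algebraMap R (reesAlgebra I) c) *
          Polynomial.monomial 1 a := by
      rw [← IsScalarTower.algebraMap_apply, Polynomial.algebraMap_eq, Polynomial.C_mul_monomial,
        smul_eq_mul]
    rw [h]
    exact isIntegral_algebraMap.mul ha

end IntegralClosure

/-! ### Newton diagrams and faces -/

/-- The ring `ℂ[[x, y]]`; `x` is the variable of index `0` and `y` the variable of index `1`. -/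
abbrev Series : Type := MvPowerSeries (Fin 2) ℂ

/-- The polynomial ring `ℂ[x, y]`. -/
abbrev Poly : Type := MvPolynomial (Fin 2) ℂ

/-- The exponent of the monomial `x ^ a * y ^ b`. -/
noncomputable def expo (a b : ℕ) : Fin 2 →₀ ℕ := Finsupp.single 0 a + Finsupp.single 1 b

/-- `Supp f`. -/
def supp (f : Series) : Set (ℕ × ℕ) := {v | MvPowerSeries.coeff (expo v.1 v.2) f ≠ 0}

/-- `Δ(E)`: the smallest convex set containing `E + ℝ₊²`. -/
def diagram (E : Set (ℕ × ℕ)) : Set (ℝ × ℝ) :=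
  convexHull ℝ {z | ∃ v ∈ E, ∃ b : ℝ × ℝ, 0 ≤ b.1 ∧ 0 ≤ b.2 ∧ z = ((v.1 : ℝ), (v.2 : ℝ)) + b}

/-- The Newton diagram `Δ(I)` of an ideal. It is generated by the supports of all elements of `I`;
those of any system of generators give the same set. -/
def idealDiagram (I : Ideal Series) : Set (ℝ × ℝ) := diagram (⋃ f ∈ I, supp f)

/-- The line `p α + q β = N` (with `p, q ≥ 1` coprime) supports a face of the Newton polygon
of `I`, that is, a one-dimensional compact face of `Δ(I)`. Since `p, q > 0`, the intersection of
`Δ(I)` with a supporting line of this form is always compact. -/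
def IsFace (I : Ideal Series) (p q N : ℕ) : Prop :=
  0 < p ∧ 0 < q ∧ Nat.Coprime p q ∧
    (∀ z ∈ idealDiagram I, (N : ℝ) ≤ p * z.1 + q * z.2) ∧
    {z ∈ idealDiagram I | (p : ℝ) * z.1 + q * z.2 = N}.Nontrivial

/-! ### Initial ideals, face polynomials and dicritical degrees -/

/-- The initial part of `f` with respect to the line `p α + q β = N`, for `p, q ≥ 1`
(then every point of `ℕ × ℕ` on the line has both coordinates at most `N`). -/
noncomputable def initialPart (p q N : ℕ) (f : Series) : Poly :=
  ∑ v ∈ (Finset.range (N + 1) ×ˢ Finset.range (N + 1)).filter (fun v => p * v.1 + q * v.2 = N),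
    MvPolynomial.monomial (expo v.1 v.2) (MvPowerSeries.coeff (expo v.1 v.2) f)

/-- The initial ideal of `I` with respect to the face supported by `p α + q β = N`.
It is generated by the initial parts of all elements of `I`; on a supporting line these are
`ℂ`-linear combinations of the initial parts of any system of generators. -/
noncomputable def initialIdeal (I : Ideal Series) (p q N : ℕ) : Ideal Poly :=
  Ideal.span {g | ∃ f ∈ I, g = initialPart p q N f}

/-- `F(x ^ q, y ^ p)`. -/
noncomputable def weightSubst (p q : ℕ) (F : Poly) : Poly :=
  MvPolynomial.aeval ![(MvPolynomial.X 0 : Poly) ^ q, (MvPolynomial.X 1 : Poly) ^ p] F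

/-- The initial ideal of `I` with respect to the line `p α + q β = N` is
`x ^ a * y ^ b * F(x ^ q, y ^ p) * (k₁(x ^ q, y ^ p), …, kₛ(x ^ q, y ^ p))`, where `F` is
homogeneous, monic in `y` and not divisible by `x` or `y`, and `k₁, …, kₛ` are coprime
homogeneous polynomials of the same degree `d`. So `F` is the face polynomial and `d` the degree
`d_S` of the face. Coprimality forces `d = 0` exactly when the initial ideal is principal. -/
def HasFaceData (I : Ideal Series) (p q N : ℕ) (F : Poly) (d : ℕ) : Prop :=
  (∃ n, F.IsHomogeneous n ∧ MvPolynomial.coeff (expo 0 n) F = 1) ∧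
  ¬ (MvPolynomial.X 0 ∣ F) ∧ ¬ (MvPolynomial.X 1 ∣ F) ∧
  ∃ (a b s : ℕ) (k : Fin s → Poly),
    (∀ i, (k i).IsHomogeneous d) ∧
    (∀ g : Poly, (∀ i, g ∣ k i) → IsUnit g) ∧
    initialIdeal I p q N =
      Ideal.span {MvPolynomial.X 0 ^ a * MvPolynomial.X 1 ^ b * weightSubst p q F} *
        Ideal.span (Set.range fun i => weightSubst p q (k i))

/-! ### Newton maps -/

/-- The data `(p, q, μ)` of a Newton map, together with the canonical `(p', q')` such that
`p p' - q q' = 1`, `p' ≤ q`, `q' < p`; these are determined by `(p, q)`, and the equation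
makes `p` and `q` coprime. -/
structure NewtonMap where
  p : ℕ
  q : ℕ
  p' : ℕ
  q' : ℕ
  μ : ℂ
  p_pos : 0 < p
  q_pos : 0 < q
  bezout : p * p' = q * q' + 1
  p'_le : p' ≤ q
  q'_lt : q' < p
  μ_ne_zero : μ ≠ 0

namespace NewtonMap

/-- The images `μ ^ q' * x ^ p` of `x` and `x ^ q * (y + μ ^ p')` of `y`. -/
noncomputable def images (σ : NewtonMap) : Fin 2 → Series :=
  ![MvPowerSeries.C (σ.μ ^ σ.q') * MvPowerSeries.X 0 ^ σ.p,
    MvPowerSeries.X 0 ^ σ.q * (MvPowerSeries.X 1 + MvPowerSeries.C (σ.μ ^ σ.p'))]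

theorem hasSubst_images (σ : NewtonMap) : MvPowerSeries.HasSubst σ.images := by
  apply MvPowerSeries.hasSubst_of_constantCoeff_zero
  intro i
  fin_cases i
  · simp [images, σ.p_pos.ne']
  · simp [images, σ.q_pos.ne']

/-- The Newton map `f(x, y) ↦ f(μ ^ q' * x ^ p, x ^ q * (y + μ ^ p'))`. -/
noncomputable def hom (σ : NewtonMap) : Series →ₐ[ℂ] Series :=
  MvPowerSeries.substAlgHom σ.hasSubst_images

/-- The ideal `I_σ` generated by the image of `I`. -/
noncomputable def mapIdeal (σ : NewtonMap) (I : Ideal Series) : Ideal Series := I.map σ.hom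

end NewtonMap

/-- The ideal `I_Σ`, for a sequence `Σ` of Newton maps. -/
noncomputable def transform (I : Ideal Series) (L : List NewtonMap) : Ideal Series :=
  L.foldl (fun J σ => σ.mapIdeal J) I

/-! ### The Newton process -/

/-- `y + h(x)`. -/
noncomputable def branchSeries (h : PowerSeries ℂ) : Series :=
  MvPowerSeries.X 1 + PowerSeries.subst (MvPowerSeries.X 0 : Series) h

/-- `I` is generated by `x ^ k * (y + h(x)) ^ ν`, with `h ∈ x ℂ[[x]]`. -/
def IsGeneratedBy (I : Ideal Series) (k : ℕ) (h : PowerSeries ℂ) (ν : ℕ) : Prop :=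
  PowerSeries.constantCoeff h = 0 ∧
    I = Ideal.span {MvPowerSeries.X 0 ^ k * branchSeries h ^ ν}

/-- `I` has depth `0`. -/
def DepthZero (I : Ideal Series) : Prop := ∃ k h ν, IsGeneratedBy I k h ν

/-- `σ = σ_(p, q, μ)`, where `p α + q β = N` supports a face of the Newton polygon of `I` and
`μ` is a root of the face polynomial. -/
def IsRootMap (I : Ideal Series) (σ : NewtonMap) : Prop :=
  ∃ N F d, IsFace I σ.p σ.q N ∧ HasFaceData I σ.p σ.q N F d ∧
    MvPolynomial.eval ![1, σ.μ] F = 0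

/-- The sequence of Newton maps occurs in the Newton algorithm of `I`: each map belongs to a root
of a face polynomial of the ideal reached so far, and the algorithm stops at ideals of depth `0`. -/
def InAlgorithm : Ideal Series → List NewtonMap → Prop
  | _, [] => True
  | I, σ :: L => ¬ DepthZero I ∧ IsRootMap I σ ∧ InAlgorithm (σ.mapIdeal I) L

/-- The elements of a Newton process. -/
inductive ProcessElement where
  /-- `(σ₁, …, σⱼ, σ_(p, q, μ); d)` with `μ` generic; the generic `μ` is not recorded. -/
  | dicritical (L : List NewtonMap) (p q d : ℕ)
  /-- `(σ₁, …, σⱼ; (y + h(x)) ^ ν)`. -/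
  | branch (L : List NewtonMap) (h : PowerSeries ℂ) (ν : ℕ)

/-- The largest `k` such that `x ^ k` divides `I` (for `I ≠ 0`). -/
noncomputable def xOrder (I : Ideal Series) : ℕ :=
  sSup {k | I ≤ Ideal.span {(MvPowerSeries.X 0 : Series) ^ k}}

/-- The largest `b` such that `y ^ b` divides `I` (for `I ≠ 0`). -/
noncomputable def yOrder (I : Ideal Series) : ℕ :=
  sSup {b | I ≤ Ideal.span {(MvPowerSeries.X 1 : Series) ^ b}}

/-- Membership in the Newton process.

* A dicritical face of some ideal `I_Σ` of positive depth in the algorithm contributes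
  `(Σ, σ_(p, q, μ); d)`.
* An ideal `I_Σ = (x ^ k * (y + h) ^ ν)` of depth `0` in the algorithm, with `ν ≥ 1`,
  contributes `(Σ; (y + h) ^ ν)`.
* An ideal `I_Σ` of positive depth in the algorithm which is divisible by `y ^ b`, with `b ≥ 1`
  maximal, contributes `(Σ; y ^ b)`. -/
def InProcess (I : Ideal Series) : ProcessElement → Prop
  | .dicritical L p q d =>
      InAlgorithm I L ∧ ¬ DepthZero (transform I L) ∧ 0 < d ∧
        ∃ N F, IsFace (transform I L) p q N ∧ HasFaceData (transform I L) p q N F d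
  | .branch L h ν =>
      InAlgorithm I L ∧ 0 < ν ∧
        ((∃ k, IsGeneratedBy (transform I L) k h ν) ∨
          (¬ DepthZero (transform I L) ∧ h = 0 ∧ ν = yOrder (transform I L)))

/-- The Newton process of a nonzero ideal: the exponent of the largest power of `x` dividing it,
and the set of pairs `(Σ; Z)`. A factor `x ^ k` of the ideal has no influence on the latter. -/
noncomputable def newtonProcess (I : Ideal Series) : ℕ × Set ProcessElement :=
  (xOrder I, {e | InProcess I e})

end NewtonAlg

/-!
An ideal `I` and its integral closure form a *reduction*: `I ⊆ J` with `J` integral over `I`.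
Whatever the form of the ideals, `I` and `J` are then contained in the same integrally closed
ideals. Principal ideals of a factorial ring are integrally closed, and so are the ideals of
`ℂ[[x, y]]` generated by products of powers of the primes `x`, `y` and `y + h(x)`; this gives the
statements about powers of `x` and `y` and about ideals of depth zero.

For a line `p α + q β = N` below the Newton diagram, the expansion of `f(t ^ p x, t ^ q y)` in
powers of `t` sends the elements of `I` and `J` to multiples of `t ^ N`. Dividing an equation of
integral dependence by the power of `t ^ N` it contains and setting `t = 0` shows that the initial
ideals again form a reduction. In the factorial ring `ℂ[x, y]` they are therefore contained in the
same principal ideals, and these determine the rest: the line supports no face exactly when the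
initial ideal is zero or contained in the ideal of a monomial of weight `N`, and `F` and `d` are
read off from the greatest common divisor of the initial ideal.

Ring homomorphisms preserve reductions, so the comparison carries over along sequences of Newton
maps.
-/

namespace NewtonAlg

/-! ### Integrality over ideals -/

section Integrality

variable {R S : Type*} [CommRing R] [CommRing S] {I J K : Ideal R}

theorem IsIntegralOver.mono (h : I ≤ J) {r : R} (hr : IsIntegralOver I r) :
    IsIntegralOver J r := by
  obtain ⟨n, hn, a, ha, e⟩ := hr
  exact ⟨n, hn, a, fun i => Ideal.pow_right_mono h i (ha i), e⟩

theorem IsIntegralOver.map {r : R} (hr : IsIntegralOver I r) (f : R →+* S) :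
    IsIntegralOver (I.map f) (f r) := by
  obtain ⟨n, hn, a, ha, e⟩ := hr
  refine ⟨n, hn, fun i => f (a i), fun i => ?_, by simpa using congrArg f e⟩
  rw [← Ideal.map_pow]
  exact Ideal.mem_map_of_mem f (ha i)

theorem IsIntegralOver.mem_radical {r : R} (hr : IsIntegralOver I r) : r ∈ I.radical := by
  obtain ⟨n, -, a, ha, e⟩ := hr
  refine ⟨n, ?_⟩
  rw [eq_neg_of_add_eq_zero_left e]
  refine I.neg_mem (I.sum_mem fun i hi => I.mul_mem_right _ ?_)
  exact Ideal.pow_le_self (Nat.one_le_iff_ne_zero.1 (Finset.mem_Icc.1 hi).1) (ha i)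

theorem IsIntegralOver.of_span_singleton_mul {s r : R} (hs : s ∈ nonZeroDivisors R)
    (hr : IsIntegralOver (Ideal.span {s} * K) (s * r)) : IsIntegralOver K r := by
  obtain ⟨n, hn, a, ha, e⟩ := hr
  have hb : ∀ i, ∃ b ∈ K ^ i, s ^ i * b = a i := fun i => by
    simpa only [mul_pow, Ideal.span_singleton_pow, Ideal.mem_span_singleton_mul] using ha i
  choose b hbK hb using hb
  refine ⟨n, hn, b, hbK, (mem_nonZeroDivisors_iff.1 (pow_mem hs n)).1 _ ?_⟩
  rw [← e, mul_add, Finset.mul_sum, mul_pow]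
  refine congrArg _ (Finset.sum_congr rfl fun i hi => ?_)
  calc s ^ n * (b i * r ^ (n - i))
      = s ^ (i + (n - i)) * (b i * r ^ (n - i)) := by
        rw [Nat.add_sub_cancel' (Finset.mem_Icc.1 hi).2]
    _ = s ^ i * b i * (s * r) ^ (n - i) := by ring
    _ = a i * (s * r) ^ (n - i) := by rw [hb]

/-- The ideal `I` is integrally closed: it contains all elements which are integral over it. -/
def IsIntegrallyClosedIdeal (I : Ideal R) : Prop := ∀ r, IsIntegralOver I r → r ∈ I

theorem isIntegrallyClosedIdeal_of_isRadical (hI : I.IsRadical) : IsIntegrallyClosedIdeal I :=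
  fun _ hr => hI hr.mem_radical

theorem isIntegrallyClosedIdeal_top : IsIntegrallyClosedIdeal (⊤ : Ideal R) :=
  fun _ _ => Submodule.mem_top

namespace IsIntegrallyClosedIdeal

theorem span_singleton_mul {s : R} (hs : s ∈ nonZeroDivisors R)
    (hI : IsIntegrallyClosedIdeal (Ideal.span {s})) (hK : IsIntegrallyClosedIdeal K) :
    IsIntegrallyClosedIdeal (Ideal.span {s} * K) := by
  intro r hr
  obtain ⟨r, rfl⟩ := Ideal.mem_span_singleton.1 (hI r (hr.mono Ideal.mul_le_left))
  exact Ideal.mul_mem_mul (Ideal.mem_span_singleton_self s) (hK r (hr.of_span_singleton_mul hs))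

variable [IsDomain R] {p : R}

theorem span_prime_mul (hp : Prime p) (hK : IsIntegrallyClosedIdeal K) :
    IsIntegrallyClosedIdeal (Ideal.span {p} * K) :=
  span_singleton_mul (mem_nonZeroDivisors_of_ne_zero hp.ne_zero)
    (isIntegrallyClosedIdeal_of_isRadical (isRadical_iff_span_singleton.1 hp.isRadical)) hK

theorem span_prime_pow_mul (hp : Prime p) (hK : IsIntegrallyClosedIdeal K) (k : ℕ) :
    IsIntegrallyClosedIdeal (Ideal.span {p ^ k} * K) := by
  induction k with
  | zero => simpa using hK
  | succ k ih =>
    rw [pow_succ', ← Ideal.span_singleton_mul_span_singleton, mul_assoc]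
    exact ih.span_prime_mul hp

theorem span_prime_pow (hp : Prime p) (k : ℕ) : IsIntegrallyClosedIdeal (Ideal.span {p ^ k}) := by
  simpa using isIntegrallyClosedIdeal_top.span_prime_pow_mul hp k

theorem span_singleton [UniqueFactorizationMonoid R] (g : R) :
    IsIntegrallyClosedIdeal (Ideal.span {g}) := by
  induction g using UniqueFactorizationMonoid.induction_on_prime with
  | h₁ =>
    exact isIntegrallyClosedIdeal_of_isRadical
      (isRadical_iff_span_singleton.1 (zero_isRadical_iff.2 inferInstance))
  | h₂ g hg =>
    rw [Ideal.span_singleton_eq_top.2 hg]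
    exact isIntegrallyClosedIdeal_top
  | h₃ g p _ hp ih =>
    rw [← Ideal.span_singleton_mul_span_singleton]
    exact ih.span_prime_mul hp

end IsIntegrallyClosedIdeal

/-- `I` is a reduction of `J`: it is contained in `J`, and `J` is integral over it. -/
structure IsReduction (I J : Ideal R) : Prop where
  le : I ≤ J
  isIntegralOver : ∀ r ∈ J, IsIntegralOver I r

theorem isReduction_integralClosure [Nontrivial R] (I : Ideal R) :
    IsReduction I (integralClosure I) where
  le r hr := ⟨1, one_pos, fun i => (-r) ^ i, fun i => Ideal.pow_mem_pow (I.neg_mem hr) i, by simp⟩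
  isIntegralOver _ hr := hr

theorem isReduction_span [Nontrivial R] {s : Set R} (hI : I ≤ Ideal.span s)
    (hs : ∀ r ∈ s, IsIntegralOver I r) : IsReduction I (Ideal.span s) where
  le := hI
  isIntegralOver _ hr := (Ideal.span_le.2 hs : Ideal.span s ≤ integralClosure I) hr

theorem IsReduction.map [Nontrivial S] (h : IsReduction I J) (f : R →+* S) :
    IsReduction (I.map f) (J.map f) := by
  refine isReduction_span (Ideal.map_mono h.le) ?_
  rintro _ ⟨r, hr, rfl⟩
  exact (h.isIntegralOver r hr).map f

theorem IsReduction.le_iff (h : IsReduction I J) (hK : IsIntegrallyClosedIdeal K) :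
    J ≤ K ↔ I ≤ K :=
  ⟨h.le.trans, fun hI r hr => hK r ((h.isIntegralOver r hr).mono hI)⟩

theorem IsReduction.eq_of_span_singleton [IsDomain R] {g : R}
    (h : IsReduction I (Ideal.span {g})) : I = Ideal.span {g} := by
  refine le_antisymm h.le ((Ideal.span_singleton_le_iff_mem I).2 ?_)
  obtain rfl | hg := eq_or_ne g 0
  · exact I.zero_mem
  -- Dividing by `g` makes `1` integral over `K = (I : g)`, so that `K = ⊤`.
  let K : Ideal R := Submodule.comap (LinearMap.mulLeft R g) I
  have hIK : I ≤ Ideal.span {g} * K := fun r hr => by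
    obtain ⟨c, rfl⟩ := Ideal.mem_span_singleton.1 (h.le hr)
    exact Ideal.mul_mem_mul (Ideal.mem_span_singleton_self g) hr
  have h_one : IsIntegralOver K 1 := by
    refine .of_span_singleton_mul (mem_nonZeroDivisors_of_ne_zero hg) (.mono hIK ?_)
    rw [mul_one]
    exact h.isIntegralOver g (Ideal.mem_span_singleton_self g)
  have hK : K = ⊤ := Ideal.radical_eq_top.1 ((Ideal.eq_top_iff_one _).2 h_one.mem_radical)
  simpa [K] using (Ideal.eq_top_iff_one K).1 hK

end Integrality

/-! ### Ideals of depth zero -/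

section DepthZero

theorem X_dvd_iff_one_le_weightedOrder {σ R : Type*} [DecidableEq σ] [Semiring R] (i : σ)
    (f : MvPowerSeries σ R) :
    MvPowerSeries.X i ∣ f ↔ 1 ≤ f.weightedOrder (Pi.single i 1) := by
  simp only [MvPowerSeries.X_dvd_iff, ← Nat.cast_one (R := ℕ∞)]
  constructor
  · refine fun h => MvPowerSeries.nat_le_weightedOrder _ fun d hd => h d ?_
    rwa [Finsupp.weight_single_one_apply, Nat.lt_one_iff] at hd
  · refine fun h d hd => MvPowerSeries.coeff_eq_zero_of_lt_weightedOrder (Pi.single i 1) ?_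
    rw [Finsupp.weight_single_one_apply, hd]
    exact (Nat.cast_lt.2 one_pos).trans_le h

theorem prime_X {σ R : Type*} [CommRing R] [IsDomain R] (i : σ) :
    Prime (MvPowerSeries.X i : MvPowerSeries σ R) := by
  classical
  refine ⟨fun h => ?_, fun h => ?_, fun f g h => ?_⟩
  · simpa using congrArg (MvPowerSeries.coeff (Finsupp.single i 1)) h
  · simpa using h.map (MvPowerSeries.constantCoeff (σ := σ) (R := R))
  · simp only [X_dvd_iff_one_le_weightedOrder, MvPowerSeries.weightedOrder_mul,
      Order.one_le_iff_ne_zero] at h ⊢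
    contrapose! h
    rw [h.1, h.2, add_zero]

theorem branchSeries_eq (h : PowerSeries ℂ) :
    branchSeries h = MvPowerSeries.X 1 + h.toMvPowerSeries 0 := by
  rw [branchSeries, PowerSeries.toMvPowerSeries_eq_subst]

/-- The images of `x` and `y` under `f(x, y) ↦ f(x, y + h(x))`. -/
noncomputable def shearImages (h : PowerSeries ℂ) : Fin 2 → Series :=
  ![MvPowerSeries.X 0, branchSeries h]

variable {g h : PowerSeries ℂ}

theorem hasSubst_shearImages (hh : PowerSeries.constantCoeff h = 0) :
    MvPowerSeries.HasSubst (shearImages h) := by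
  refine MvPowerSeries.hasSubst_of_constantCoeff_zero fun i => ?_
  fin_cases i
  · simp [shearImages]
  · have := PowerSeries.toMvPowerSeries_coeff_eq_zero (i := (0 : Fin 2)) (d := 0) rfl hh
    simp_all [shearImages, branchSeries_eq]

theorem subst_shearImages_branchSeries (hh : PowerSeries.constantCoeff h = 0) :
    MvPowerSeries.subst (shearImages h) (branchSeries g) = branchSeries (g + h) := by
  have hs := hasSubst_shearImages hh
  calc MvPowerSeries.subst (shearImages h) (branchSeries g)
      = branchSeries h + PowerSeries.subst (MvPowerSeries.X 0 : Series) g := by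
        rw [branchSeries_eq g, MvPowerSeries.subst_add hs, MvPowerSeries.subst_X hs,
          PowerSeries.subst_toMvPowerSeries hs]
        rfl
    _ = branchSeries (g + h) := by
        rw [← PowerSeries.toMvPowerSeries_eq_subst, branchSeries_eq, branchSeries_eq, map_add]
        ring

theorem subst_shearImages_subst (hg : PowerSeries.constantCoeff g = 0)
    (hh : PowerSeries.constantCoeff h = 0) (f : Series) :
    MvPowerSeries.subst (shearImages h) (MvPowerSeries.subst (shearImages g) f) =
      MvPowerSeries.subst (shearImages (g + h)) f := by
  have hs := hasSubst_shearImages hh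
  rw [MvPowerSeries.subst_comp_subst_apply (hasSubst_shearImages hg) hs]
  congr 1
  funext i
  fin_cases i
  · exact MvPowerSeries.subst_X hs 0
  · exact subst_shearImages_branchSeries hh

theorem shearImages_zero : shearImages 0 = MvPowerSeries.X := by
  funext i
  fin_cases i
  · rfl
  · simp [shearImages, branchSeries_eq]

/-- The automorphism `f(x, y) ↦ f(x, y + h(x))`, which moves the curve `y = 0` to the branch
`y + h(x) = 0`. -/
noncomputable def shear (hh : PowerSeries.constantCoeff h = 0) : Series ≃* Series where
  toFun := MvPowerSeries.subst (shearImages h)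
  invFun := MvPowerSeries.subst (shearImages (-h))
  left_inv f := by
    rw [subst_shearImages_subst hh (by simp [hh]), add_neg_cancel, shearImages_zero,
      MvPowerSeries.subst_self, id]
  right_inv f := by
    rw [subst_shearImages_subst (by simp [hh]) hh, neg_add_cancel, shearImages_zero,
      MvPowerSeries.subst_self, id]
  map_mul' := MvPowerSeries.subst_mul (hasSubst_shearImages hh)

theorem prime_branchSeries (hh : PowerSeries.constantCoeff h = 0) : Prime (branchSeries h) := by
  have : shear hh (MvPowerSeries.X 1) = branchSeries h :=
    MvPowerSeries.subst_X (hasSubst_shearImages hh) 1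
  rw [← this, MulEquiv.prime_iff]
  exact prime_X 1

instance : IsDomain Series := NoZeroDivisors.to_isDomain _

variable {I J : Ideal Series}

theorem IsReduction.isGeneratedBy_iff (hIJ : IsReduction I J) (k : ℕ) (h : PowerSeries ℂ)
    (ν : ℕ) : IsGeneratedBy J k h ν ↔ IsGeneratedBy I k h ν := by
  refine and_congr_right fun hh => ⟨?_, ?_⟩
  · rintro rfl
    exact hIJ.eq_of_span_singleton
  · rintro rfl
    refine le_antisymm ((hIJ.le_iff ?_).2 le_rfl) hIJ.le
    rw [← Ideal.span_singleton_mul_span_singleton]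
    exact (IsIntegrallyClosedIdeal.span_prime_pow (prime_branchSeries hh) ν).span_prime_pow_mul
      (prime_X 0) k

theorem IsReduction.depthZero_iff (hIJ : IsReduction I J) : DepthZero J ↔ DepthZero I := by
  simp only [DepthZero, hIJ.isGeneratedBy_iff]

theorem IsReduction.xOrder_eq (hIJ : IsReduction I J) : xOrder J = xOrder I := by
  simp only [xOrder, hIJ.le_iff (.span_prime_pow (prime_X 0) _)]

theorem IsReduction.yOrder_eq (hIJ : IsReduction I J) : yOrder J = yOrder I := by
  simp only [yOrder, hIJ.le_iff (.span_prime_pow (prime_X 1) _)]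

end DepthZero

/-! ### Initial ideals -/

section InitialIdeal

theorem weight_pair (p q : ℕ) (d : Fin 2 →₀ ℕ) :
    Finsupp.weight ![p, q] d = p * d 0 + q * d 1 := by
  simp [Finsupp.weight_eq_sum, mul_comm]

theorem expo_self (d : Fin 2 →₀ ℕ) : expo (d 0) (d 1) = d := by
  ext i
  fin_cases i <;> simp [expo]

@[simp] theorem expo_zero (a b : ℕ) : expo a b 0 = a := by simp [expo]

@[simp] theorem expo_one (a b : ℕ) : expo a b 1 = b := by simp [expo]

variable {I J : Ideal Series} {p q N : ℕ}

theorem coeff_initialPart (hp : 0 < p) (hq : 0 < q) (N : ℕ) (f : Series) (d : Fin 2 →₀ ℕ) :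
    MvPolynomial.coeff d (initialPart p q N f) =
      if Finsupp.weight ![p, q] d = N then MvPowerSeries.coeff d f else 0 := by
  classical
  have hd : ∀ v : ℕ × ℕ, expo v.1 v.2 = d ↔ v = (d 0, d 1) := by
    refine fun v => ⟨?_, ?_⟩
    · rintro rfl
      simp
    · rintro rfl
      exact expo_self d
  simp only [initialPart, MvPolynomial.coeff_sum, MvPolynomial.coeff_monomial, hd,
    Finset.sum_ite_eq', Finset.mem_filter, Finset.mem_product, Finset.mem_range, expo_self,
    weight_pair]
  refine if_congr (and_iff_right_of_imp fun h => ⟨?_, ?_⟩) rfl rfl <;> nlinarith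

theorem initialPart_mul (hp : 0 < p) (hq : 0 < q) (N : ℕ) (f g : Series) :
    initialPart p q N (f * g) = ∑ m ∈ Finset.HasAntidiagonal.antidiagonal N,
      initialPart p q m.1 f * initialPart p q m.2 g := by
  classical
  ext d
  have key : ∀ u ∈ Finset.HasAntidiagonal.antidiagonal d,
      (if Finsupp.weight ![p, q] d = N then
        MvPowerSeries.coeff u.1 f * MvPowerSeries.coeff u.2 g else 0) =
      ∑ m ∈ Finset.HasAntidiagonal.antidiagonal N, MvPolynomial.coeff u.1 (initialPart p q m.1 f) *
        MvPolynomial.coeff u.2 (initialPart p q m.2 g) := by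
    intro u hu
    simp only [coeff_initialPart hp hq, ite_zero_mul_ite_zero, ← Prod.mk_inj (β := ℕ) (α := ℕ),
      Prod.mk.eta, Finset.sum_ite_eq, Finset.HasAntidiagonal.mem_antidiagonal, ← map_add]
    rw [Finset.HasAntidiagonal.mem_antidiagonal.1 hu]
  simp only [MvPolynomial.coeff_sum, MvPolynomial.coeff_mul]
  rw [Finset.sum_comm, ← Finset.sum_congr rfl key, coeff_initialPart hp hq, MvPowerSeries.coeff_mul]
  split_ifs <;> simp

/-- The ring homomorphism `f(x, y) ↦ f(t ^ p x, t ^ q y)`: the coefficient of `t ^ N` is the part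
of weight `N` of `f`. -/
noncomputable def weightExpansion (hp : 0 < p) (hq : 0 < q) : Series →+* PowerSeries Poly where
  toFun f := PowerSeries.mk fun N => initialPart p q N f
  map_one' := by
    classical
    ext N d
    simp only [PowerSeries.coeff_mk, coeff_initialPart hp hq, PowerSeries.coeff_one,
      MvPowerSeries.coeff_one, apply_ite (MvPolynomial.coeff d), MvPolynomial.coeff_one,
      MvPolynomial.coeff_zero]
    obtain rfl | hd := eq_or_ne d 0
    · simp [eq_comm]
    · simp [hd, hd.symm]
  map_zero' := by
    ext N d
    simp [coeff_initialPart hp hq]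
  map_add' f g := by
    ext N d
    simp only [PowerSeries.coeff_mk, coeff_initialPart hp hq, map_add, MvPolynomial.coeff_add]
    split_ifs <;> simp
  map_mul' f g := by
    ext1 N
    simp only [PowerSeries.coeff_mul, PowerSeries.coeff_mk, initialPart_mul hp hq]

theorem coeff_weightExpansion (hp : 0 < p) (hq : 0 < q) (N : ℕ) (f : Series) :
    PowerSeries.coeff N (weightExpansion hp hq f) = initialPart p q N f :=
  PowerSeries.coeff_mk N fun N => initialPart p q N f

theorem X_pow_dvd_weightExpansion_iff (hp : 0 < p) (hq : 0 < q) (N : ℕ) (f : Series) :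
    PowerSeries.X ^ N ∣ weightExpansion hp hq f ↔ N ≤ f.weightedOrder ![p, q] := by
  simp only [PowerSeries.X_pow_dvd_iff, coeff_weightExpansion]
  constructor
  · refine fun h => MvPowerSeries.nat_le_weightedOrder _ fun d hd => ?_
    simpa [coeff_initialPart hp hq] using congrArg (MvPolynomial.coeff d) (h _ hd)
  · intro h m hm
    ext d
    rw [coeff_initialPart hp hq, MvPolynomial.coeff_zero]
    split_ifs with hd
    · refine MvPowerSeries.coeff_eq_zero_of_lt_weightedOrder ![p, q] (lt_of_lt_of_le ?_ h)
      exact_mod_cast hd.trans_lt hm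
    · rfl

theorem constantCoeff_eq_initialPart {hp : 0 < p} {hq : 0 < q} {f : Series}
    {u : PowerSeries Poly} (hu : weightExpansion hp hq f = PowerSeries.X ^ N * u) :
    PowerSeries.constantCoeff u = initialPart p q N f := by
  rw [← coeff_weightExpansion hp hq, hu, ← PowerSeries.coeff_zero_eq_constantCoeff_apply]
  simpa using (PowerSeries.coeff_X_pow_mul u N 0).symm

/-- The line `p α + q β = N` lies below the Newton diagram of `I`: all elements of `I` have order
at least `N` for the weights `p` of `x` and `q` of `y`. -/
def WeightGE (I : Ideal Series) (p q N : ℕ) : Prop := ∀ f ∈ I, N ≤ f.weightedOrder ![p, q]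

theorem map_weightExpansion_le_iff (hp : 0 < p) (hq : 0 < q) :
    I.map (weightExpansion hp hq) ≤ Ideal.span {PowerSeries.X ^ N} ↔ WeightGE I p q N := by
  rw [Ideal.map_le_iff_le_comap]
  simp only [SetLike.le_def, Ideal.mem_comap, Ideal.mem_span_singleton,
    X_pow_dvd_weightExpansion_iff, WeightGE]

theorem IsReduction.weightGE_iff (hIJ : IsReduction I J) (hp : 0 < p) (hq : 0 < q) :
    WeightGE J p q N ↔ WeightGE I p q N := by
  rw [← map_weightExpansion_le_iff hp hq, ← map_weightExpansion_le_iff hp hq,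
    (hIJ.map _).le_iff (.span_prime_pow PowerSeries.X_prime N)]

theorem initialPart_mem_initialIdeal {f : Series} (hf : f ∈ I) (p q N : ℕ) :
    initialPart p q N f ∈ initialIdeal I p q N :=
  Ideal.subset_span ⟨f, hf, rfl⟩

theorem initialIdeal_le_iff {K : Ideal Poly} :
    initialIdeal I p q N ≤ K ↔ ∀ f ∈ I, initialPart p q N f ∈ K := by
  refine ⟨fun h f hf => h (initialPart_mem_initialIdeal hf p q N), fun h => Ideal.span_le.2 ?_⟩
  rintro _ ⟨f, hf, rfl⟩
  exact h f hf

theorem WeightGE.map_weightExpansion_le (h : WeightGE I p q N) (hp : 0 < p) (hq : 0 < q) :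
    I.map (weightExpansion hp hq) ≤ Ideal.span {PowerSeries.X ^ N} *
      (initialIdeal I p q N).comap PowerSeries.constantCoeff := by
  refine Ideal.map_le_iff_le_comap.2 fun f hf => ?_
  obtain ⟨u, hu⟩ := (X_pow_dvd_weightExpansion_iff hp hq N f).2 (h f hf)
  rw [Ideal.mem_comap, hu]
  refine Ideal.mul_mem_mul (Ideal.mem_span_singleton_self _) (Ideal.mem_comap.2 ?_)
  rw [constantCoeff_eq_initialPart hu]
  exact initialPart_mem_initialIdeal hf p q N

theorem IsReduction.isReduction_initialIdeal (hIJ : IsReduction I J) (hp : 0 < p) (hq : 0 < q)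
    (h : WeightGE I p q N) : IsReduction (initialIdeal I p q N) (initialIdeal J p q N) := by
  refine isReduction_span
    (initialIdeal_le_iff.2 fun f hf => initialPart_mem_initialIdeal (hIJ.le hf) p q N) ?_
  rintro _ ⟨f, hf, rfl⟩
  obtain ⟨u, hu⟩ := (X_pow_dvd_weightExpansion_iff hp hq N f).2 ((hIJ.weightGE_iff hp hq).2 h f hf)
  have hXu : IsIntegralOver (I.map (weightExpansion hp hq)) (PowerSeries.X ^ N * u) :=
    hu ▸ (hIJ.isIntegralOver f hf).map _
  have hu_int : IsIntegralOver ((initialIdeal I p q N).comap PowerSeries.constantCoeff) u :=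
    .of_span_singleton_mul (mem_nonZeroDivisors_of_ne_zero (pow_ne_zero N PowerSeries.X_ne_zero))
      (hXu.mono (h.map_weightExpansion_le hp hq))
  rw [← constantCoeff_eq_initialPart hu]
  exact (hu_int.map PowerSeries.constantCoeff).mono Ideal.map_comap_le

end InitialIdeal

/-! ### Faces -/

section Faces

theorem convex_setOf_le_and_eq_imp_mem {𝕜 E : Type*} [Field 𝕜] [LinearOrder 𝕜]
    [IsStrictOrderedRing 𝕜] [AddCommGroup E] [Module 𝕜 E] {C : Set E} (hC : Convex 𝕜 C)
    (φ : E →ₗ[𝕜] 𝕜) (r : 𝕜) : Convex 𝕜 {z | r ≤ φ z ∧ (φ z = r → z ∈ C)} := by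
  refine convex_iff_forall_pos.2 ?_
  rintro z ⟨hz, hzC⟩ w ⟨hw, hwC⟩ a b ha hb hab
  have hr : a * r + b * r = r := by rw [← add_mul, hab, one_mul]
  have haz : a * r ≤ a * φ z := mul_le_mul_of_nonneg_left hz ha.le
  have hbw : b * r ≤ b * φ w := mul_le_mul_of_nonneg_left hw hb.le
  simp only [Set.mem_ofPred_eq, map_add, map_smul, smul_eq_mul]
  refine ⟨by linarith, fun h => hC (hzC ?_) (hwC ?_) ha.le hb.le hab⟩
  · exact mul_left_cancel₀ ha.ne' (by linarith)
  · exact mul_left_cancel₀ hb.ne' (by linarith)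

/-- The point of the real plane whose coordinates are the exponents in `d`. -/
def point (d : Fin 2 →₀ ℕ) : ℝ × ℝ := (d 0, d 1)

theorem point_injective : Function.Injective point := by
  intro d e h
  simp only [point, Prod.mk.injEq, Nat.cast_inj] at h
  rw [← expo_self d, h.1, h.2, expo_self]

theorem cast_weight_pair (p q : ℕ) (d : Fin 2 →₀ ℕ) :
    ((Finsupp.weight ![p, q] d : ℕ) : ℝ) = p * (point d).1 + q * (point d).2 := by
  simp [weight_pair, point]

variable {I J : Ideal Series} {p q N : ℕ}

theorem point_mem_idealDiagram {f : Series} (hf : f ∈ I) {d : Fin 2 →₀ ℕ}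
    (hd : MvPowerSeries.coeff d f ≠ 0) : point d ∈ idealDiagram I := by
  have hd' : (d 0, d 1) ∈ supp f := by rwa [supp, Set.mem_ofPred_eq, expo_self]
  exact subset_convexHull ℝ _ ⟨_, Set.mem_biUnion hf hd', 0, le_rfl, le_rfl, (add_zero _).symm⟩

theorem idealDiagram_subset_of_convex {C : Set (ℝ × ℝ)} (hC : Convex ℝ C)
    (h : ∀ f ∈ I, ∀ d, MvPowerSeries.coeff d f ≠ 0 → ∀ b : ℝ × ℝ, 0 ≤ b.1 → 0 ≤ b.2 →
      point d + b ∈ C) : idealDiagram I ⊆ C := by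
  refine convexHull_min ?_ hC
  rintro _ ⟨v, hv, b, hb₁, hb₂, rfl⟩
  obtain ⟨f, hf, hv⟩ := Set.mem_iUnion₂.1 hv
  simpa [point] using h f hf (expo v.1 v.2) hv b hb₁ hb₂

/-- The exponents on the line `p α + q β = N` of the monomials occurring in elements of `I`. -/
def contactSet (I : Ideal Series) (p q N : ℕ) : Set (Fin 2 →₀ ℕ) :=
  {d | Finsupp.weight ![p, q] d = N ∧ ∃ f ∈ I, MvPowerSeries.coeff d f ≠ 0}

theorem weightGE_iff_forall_coeff_ne_zero : WeightGE I p q N ↔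
    ∀ f ∈ I, ∀ d, MvPowerSeries.coeff d f ≠ 0 → N ≤ Finsupp.weight ![p, q] d := by
  refine forall₂_congr fun f _ => ⟨fun h d hd => ?_, fun h => ?_⟩
  · exact_mod_cast h.trans (MvPowerSeries.weightedOrder_le _ hd)
  · exact MvPowerSeries.nat_le_weightedOrder _ fun d hd => not_not.1 fun hne => hd.not_ge (h d hne)

theorem WeightGE.idealDiagram_subset (h : WeightGE I p q N) (hp : 0 < p) (hq : 0 < q) :
    idealDiagram I ⊆ {z | (N : ℝ) ≤ p * z.1 + q * z.2 ∧
      (p * z.1 + q * z.2 = N → z ∈ convexHull ℝ (point '' contactSet I p q N))} := by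
  refine idealDiagram_subset_of_convex ?_ fun f hf d hd b hb₁ hb₂ => ?_
  · exact convex_setOf_le_and_eq_imp_mem (convex_convexHull ℝ _)
      ((p : ℝ) • LinearMap.fst ℝ ℝ ℝ + (q : ℝ) • LinearMap.snd ℝ ℝ ℝ) N
  have hp' : (0 : ℝ) < p := Nat.cast_pos.2 hp
  have hq' : (0 : ℝ) < q := Nat.cast_pos.2 hq
  have hNd : (N : ℝ) ≤ p * (point d).1 + q * (point d).2 := by
    rw [← cast_weight_pair]
    exact Nat.cast_le.2 (weightGE_iff_forall_coeff_ne_zero.1 h f hf d hd)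
  have hpb : 0 ≤ p * b.1 := mul_nonneg hp'.le hb₁
  have hqb : 0 ≤ q * b.2 := mul_nonneg hq'.le hb₂
  simp only [Set.mem_ofPred_eq, Prod.fst_add, Prod.snd_add]
  refine ⟨by linarith, fun hN => subset_convexHull ℝ _ ⟨d, ⟨?_, f, hf, hd⟩, ?_⟩⟩
  · have : (p * (point d).1 + q * (point d).2 : ℝ) = N := by linarith
    exact_mod_cast (cast_weight_pair p q d).trans this
  · have hb₁' : b.1 = 0 := (mul_eq_zero.1 (by linarith : (p : ℝ) * b.1 = 0)).resolve_left hp'.ne'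
    have hb₂' : b.2 = 0 := (mul_eq_zero.1 (by linarith : (q : ℝ) * b.2 = 0)).resolve_left hq'.ne'
    rw [Prod.ext hb₁' hb₂' (y := 0), add_zero]

theorem weightGE_iff_forall_mem_idealDiagram (hp : 0 < p) (hq : 0 < q) :
    WeightGE I p q N ↔ ∀ z ∈ idealDiagram I, (N : ℝ) ≤ p * z.1 + q * z.2 := by
  refine ⟨fun h z hz => (h.idealDiagram_subset hp hq hz).1, fun h => ?_⟩
  refine weightGE_iff_forall_coeff_ne_zero.2 fun f hf d hd => ?_
  rw [← Nat.cast_le (α := ℝ), cast_weight_pair]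
  exact h _ (point_mem_idealDiagram hf hd)

theorem isFace_iff_contactSet_nontrivial : IsFace I p q N ↔
    0 < p ∧ 0 < q ∧ Nat.Coprime p q ∧ WeightGE I p q N ∧ (contactSet I p q N).Nontrivial := by
  refine and_congr_right fun hp => and_congr_right fun hq => and_congr_right fun _ => ?_
  rw [← weightGE_iff_forall_mem_idealDiagram hp hq]
  refine and_congr_right fun h => ⟨fun hface => ?_, fun hcontact => ?_⟩
  · contrapose! hface
    have hs := hface.image point
    refine hs.anti fun z hz => ?_
    rw [← (hs.convex (𝕜 := ℝ)).convexHull_eq]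
    exact (h.idealDiagram_subset hp hq hz.1).2 hz.2
  · refine (hcontact.image point_injective).mono ?_
    rintro _ ⟨d, ⟨hN, f, hf, hd⟩, rfl⟩
    exact ⟨point_mem_idealDiagram hf hd, by rw [← cast_weight_pair, hN]⟩

theorem mem_contactSet_iff (hp : 0 < p) (hq : 0 < q) {d : Fin 2 →₀ ℕ} :
    d ∈ contactSet I p q N ↔ ∃ f ∈ I, d ∈ (initialPart p q N f).support := by
  simp only [contactSet, Set.mem_ofPred_eq, MvPolynomial.mem_support_iff,
    coeff_initialPart hp hq, ne_eq, ite_eq_right_iff, Classical.not_imp, ← exists_and_left,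
    and_left_comm]

theorem initialIdeal_le_span_zero_iff (hp : 0 < p) (hq : 0 < q) :
    initialIdeal I p q N ≤ Ideal.span {0} ↔ contactSet I p q N = ∅ := by
  simp only [Set.eq_empty_iff_forall_notMem, mem_contactSet_iff hp hq, initialIdeal_le_iff,
    Ideal.mem_span_singleton, zero_dvd_iff, ← MvPolynomial.support_eq_empty,
    Finset.eq_empty_iff_forall_notMem, not_exists, not_and]
  tauto

theorem eq_of_le_of_weight_eq (hp : 0 < p) (hq : 0 < q) {d e : Fin 2 →₀ ℕ} (hle : e ≤ d)
    (hw : Finsupp.weight ![p, q] e = Finsupp.weight ![p, q] d) : d = e := by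
  obtain ⟨c, rfl⟩ := exists_add_of_le hle
  rw [map_add, left_eq_add, weight_pair, Nat.add_eq_zero_iff] at hw
  have h₀ : c 0 = 0 := (mul_eq_zero.1 hw.1).resolve_left hp.ne'
  have h₁ : c 1 = 0 := (mul_eq_zero.1 hw.2).resolve_left hq.ne'
  rw [← expo_self c, h₀, h₁]
  simp [expo]

theorem initialIdeal_le_span_monomial_iff (hp : 0 < p) (hq : 0 < q) {e : Fin 2 →₀ ℕ}
    (he : Finsupp.weight ![p, q] e = N) :
    initialIdeal I p q N ≤ Ideal.span {MvPolynomial.monomial e 1} ↔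
      contactSet I p q N ⊆ {e} := by
  have hmem (f : Poly) : f ∈ Ideal.span {(MvPolynomial.monomial e 1 : Poly)} ↔
      ∀ d ∈ f.support, e ≤ d := by
    simpa using MvPolynomial.mem_ideal_span_monomial_image (x := f) (s := {e})
  simp only [initialIdeal_le_iff, hmem]
  constructor
  · intro h d hd
    obtain ⟨f, hf, hdf⟩ := (mem_contactSet_iff hp hq).1 hd
    exact eq_of_le_of_weight_eq hp hq (h f hf d hdf) (he.trans hd.1.symm)
  · intro h f hf d hd
    exact (h ((mem_contactSet_iff hp hq).2 ⟨f, hf, hd⟩)).ge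

theorem contactSet_subsingleton_iff (hp : 0 < p) (hq : 0 < q) :
    (contactSet I p q N).Subsingleton ↔ initialIdeal I p q N ≤ Ideal.span {0} ∨
      ∃ e, Finsupp.weight ![p, q] e = N ∧
        initialIdeal I p q N ≤ Ideal.span {MvPolynomial.monomial e 1} := by
  rw [initialIdeal_le_span_zero_iff hp hq]
  constructor
  · intro h
    refine (contactSet I p q N).eq_empty_or_nonempty.imp_right ?_
    rintro ⟨e, he⟩
    exact ⟨e, he.1, (initialIdeal_le_span_monomial_iff hp hq he.1).2 fun d hd => h hd he⟩
  · rintro (h | ⟨e, he, h⟩)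
    · exact h ▸ Set.subsingleton_empty
    · exact Set.subsingleton_singleton.anti ((initialIdeal_le_span_monomial_iff hp hq he).1 h)

theorem IsReduction.isFace_iff (hIJ : IsReduction I J) : IsFace J p q N ↔ IsFace I p q N := by
  rw [isFace_iff_contactSet_nontrivial, isFace_iff_contactSet_nontrivial]
  refine and_congr_right fun hp => and_congr_right fun hq => and_congr_right fun _ => ?_
  rw [hIJ.weightGE_iff hp hq]
  refine and_congr_right fun h => ?_
  have hred := hIJ.isReduction_initialIdeal hp hq h
  rw [← not_iff_not, Set.not_nontrivial_iff, Set.not_nontrivial_iff,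
    contactSet_subsingleton_iff hp hq, contactSet_subsingleton_iff hp hq]
  simp only [hred.le_iff (.span_singleton _)]

end Faces

/-! ### The substitution `F(x ^ q, y ^ p)` -/

section WeightSubst

variable {σ R M : Type*} {w : σ → M} {k l : M}

theorem isWeightedHomogeneous_of_mul_left [CommRing R] [NoZeroDivisors R] [AddCancelCommMonoid M]
    {g m : MvPolynomial σ R} (hg₀ : g ≠ 0) (hg : g.IsWeightedHomogeneous w k)
    (hgm : (g * m).IsWeightedHomogeneous w (k + l)) : m.IsWeightedHomogeneous w l := by
  classical
  let := MvPolynomial.weightedGradedAlgebra R w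
  have hcomp : MvPolynomial.weightedHomogeneousComponent w (k + l) (g * m) =
      g * MvPolynomial.weightedHomogeneousComponent w l m := by
    rw [← MvPolynomial.decompose'_apply, ← MvPolynomial.decompose'_apply]
    exact DirectSum.coe_decompose_mul_add_of_left_mem
      (MvPolynomial.weightedHomogeneousSubmodule R w) hg
  rw [hgm.weightedHomogeneousComponent_same] at hcomp
  rw [mul_left_cancel₀ hg₀ hcomp]
  exact MvPolynomial.weightedHomogeneousComponent_isWeightedHomogeneous l m

theorem le_of_mem_span_of_isWeightedHomogeneous [CommSemiring R] [AddCommMonoid M] [PartialOrder M]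
    [CanonicallyOrderedAdd M] {S : Set (MvPolynomial σ R)}
    (hS : ∀ g ∈ S, MvPolynomial.IsWeightedHomogeneous w g k) {f : MvPolynomial σ R} (hf₀ : f ≠ 0)
    (hf : f.IsWeightedHomogeneous w l) (hfS : f ∈ Ideal.span S) : k ≤ l := by
  classical
  have hweight : ∀ d ∈ f.support, k ≤ Finsupp.weight w d := by
    clear hf hf₀
    induction hfS using Submodule.span_induction with
    | mem g hg => exact fun d hd => (hS g hg (MvPolynomial.mem_support_iff.1 hd)).ge
    | zero => simp
    | add f g _ _ hf hg =>
      intro d hd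
      exact (Finset.mem_union.1 (MvPolynomial.support_add hd)).elim (hf d) (hg d)
    | smul c f _ hf =>
      intro d hd
      obtain ⟨u, -, v, hv, rfl⟩ := Finset.mem_add.1 (MvPolynomial.support_mul c f hd)
      rw [map_add]
      exact (hf v hv).trans le_add_self
  obtain ⟨d, hd⟩ := MvPolynomial.support_nonempty.2 hf₀
  exact (hweight d hd).trans_eq (hf (MvPolynomial.mem_support_iff.1 hd))

variable {p q : ℕ}

theorem weightSubst_monomial (p q : ℕ) (d : Fin 2 →₀ ℕ) (c : ℂ) :
    weightSubst p q (MvPolynomial.monomial d c) =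
      MvPolynomial.monomial (expo (q * d 0) (p * d 1)) c := by
  rw [weightSubst, MvPolynomial.aeval_monomial, MvPolynomial.monomial_eq,
    Finsupp.prod_fintype _ _ (by simp), Finsupp.prod_fintype _ _ (by simp)]
  simp [← pow_mul, MvPolynomial.algebraMap_eq]

theorem weightSubst_sum {ι : Type*} (p q : ℕ) (s : Finset ι) (F : ι → Poly) :
    weightSubst p q (∑ i ∈ s, F i) = ∑ i ∈ s, weightSubst p q (F i) :=
  map_sum _ _ _

theorem isWeightedHomogeneous_weightSubst (p q : ℕ) {F : Poly} {n : ℕ} (hF : F.IsHomogeneous n) :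
    (weightSubst p q F).IsWeightedHomogeneous ![p, q] (p * q * n) := by
  rw [F.as_sum, weightSubst_sum]
  refine MvPolynomial.IsWeightedHomogeneous.sum _ _ _ fun d hd => ?_
  rw [weightSubst_monomial]
  refine MvPolynomial.isWeightedHomogeneous_monomial _ _ _ ?_
  have hn : d 0 + d 1 = n := by
    simpa [Finsupp.weight_eq_sum] using hF (MvPolynomial.mem_support_iff.1 hd)
  rw [weight_pair, expo_zero, expo_one, ← hn]
  ring

theorem exists_weightSubst_eq (hp : 0 < p) (hq : 0 < q) (hpq : Nat.Coprime p q)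
    {m : Poly} {d : ℕ} (hm : m.IsWeightedHomogeneous ![p, q] (p * q * d)) :
    ∃ k : Poly, k.IsHomogeneous d ∧ weightSubst p q k = m := by
  have hsupp : ∀ v ∈ m.support, ∃ i j, v = expo (q * i) (p * j) ∧ i + j = d := by
    intro v hv
    have hv : p * v 0 + q * v 1 = p * q * d := by
      rw [← weight_pair, hm (MvPolynomial.mem_support_iff.1 hv)]
    obtain ⟨i, hi⟩ : q ∣ v 0 := by
      refine hpq.symm.dvd_of_dvd_mul_left ((Nat.dvd_add_left (dvd_mul_right q (v 1))).1 ?_)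
      exact hv ▸ ⟨p * d, by ring⟩
    obtain ⟨j, hj⟩ : p ∣ v 1 := by
      refine hpq.dvd_of_dvd_mul_left ((Nat.dvd_add_right (dvd_mul_right p (v 0))).1 ?_)
      exact hv ▸ ⟨q * d, by ring⟩
    refine ⟨i, j, by rw [← hi, ← hj, expo_self], ?_⟩
    rw [hi, hj] at hv
    exact Nat.eq_of_mul_eq_mul_left (Nat.mul_pos hp hq) (by linarith)
  refine ⟨∑ v ∈ m.support, MvPolynomial.monomial (expo (v 0 / q) (v 1 / p)) (m.coeff v), ?_, ?_⟩
  · refine MvPolynomial.IsHomogeneous.sum _ _ _ fun v hv => ?_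
    obtain ⟨i, j, rfl, rfl⟩ := hsupp v hv
    refine MvPolynomial.isHomogeneous_monomial _ ?_
    simp [expo, hp, hq]
  · conv_rhs => rw [m.as_sum]
    rw [weightSubst_sum]
    refine Finset.sum_congr rfl fun v hv => ?_
    obtain ⟨i, j, rfl, -⟩ := hsupp v hv
    rw [weightSubst_monomial]
    simp [hp, hq]

/-- The linear retraction of `F ↦ F(x ^ q, y ^ p)` which sends `x ^ (q * i) * y ^ (p * j)` to
`x ^ i * y ^ j` and the other monomials to zero. -/
noncomputable def weightContract (p q : ℕ) : Poly →ₗ[ℂ] Poly :=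
  (MvPolynomial.basisMonomials (Fin 2) ℂ).constr ℂ fun d =>
    if q ∣ d 0 ∧ p ∣ d 1 then MvPolynomial.monomial (expo (d 0 / q) (d 1 / p)) 1 else 0

theorem weightContract_monomial (p q : ℕ) (d : Fin 2 →₀ ℕ) (c : ℂ) :
    weightContract p q (MvPolynomial.monomial d c) =
      if q ∣ d 0 ∧ p ∣ d 1 then MvPolynomial.monomial (expo (d 0 / q) (d 1 / p)) c else 0 := by
  have hc : (MvPolynomial.monomial d c : Poly) = c • MvPolynomial.basisMonomials (Fin 2) ℂ d := by
    simp [MvPolynomial.smul_monomial]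
  rw [hc, map_smul, weightContract, Module.Basis.constr_basis]
  split_ifs <;> simp [MvPolynomial.smul_monomial]

theorem weightContract_weightSubst_mul (hp : 0 < p) (hq : 0 < q) (h m : Poly) :
    weightContract p q (weightSubst p q h * m) = h * weightContract p q m := by
  induction h using MvPolynomial.induction_on' with
  | add f g hf hg =>
    rw [show weightSubst p q (f + g) = weightSubst p q f + weightSubst p q g from map_add _ f g,
      add_mul, map_add, hf, hg, add_mul]
  | monomial u a =>
    induction m using MvPolynomial.induction_on' with
    | add f g hf hg => rw [mul_add, map_add, hf, hg, map_add, mul_add]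
    | monomial v b =>
      rw [weightSubst_monomial, MvPolynomial.monomial_mul, weightContract_monomial,
        weightContract_monomial]
      simp only [Finsupp.add_apply, expo_zero, expo_one, Nat.dvd_add_right (dvd_mul_right _ _),
        mul_ite, mul_zero, MvPolynomial.monomial_mul, Nat.mul_add_div hp, Nat.mul_add_div hq]
      congr 3
      ext i
      fin_cases i <;> simp

theorem weightContract_weightSubst (hp : 0 < p) (hq : 0 < q) (k : Poly) :
    weightContract p q (weightSubst p q k) = k := by
  have h₁ : weightContract p q 1 = 1 := by
    rw [← MvPolynomial.C_1, MvPolynomial.C_apply, weightContract_monomial]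
    simp [expo]
  simpa [h₁] using weightContract_weightSubst_mul hp hq k 1

theorem weightSubst_dvd_weightSubst_iff (hp : 0 < p) (hq : 0 < q) {h k : Poly} :
    weightSubst p q h ∣ weightSubst p q k ↔ h ∣ k := by
  refine ⟨fun ⟨m, hm⟩ => ⟨weightContract p q m, ?_⟩, fun hhk => map_dvd (MvPolynomial.aeval _) hhk⟩
  rw [← weightContract_weightSubst_mul hp hq, ← hm, weightContract_weightSubst hp hq]

theorem weightSubst_ne_zero (hp : 0 < p) (hq : 0 < q) {k : Poly} (hk : k ≠ 0) :
    weightSubst p q k ≠ 0 := by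
  rw [← map_zero (weightContract p q)] at hk
  exact fun h => hk (by rw [← weightContract_weightSubst hp hq k, h])

end WeightSubst

/-! ### Face data -/

section FaceData

theorem exists_fin_family_span_eq {R : Type*} [Semiring R] [IsNoetherianRing R] (S : Set R) :
    ∃ (n : ℕ) (k : Fin n → R), (∀ i, k i ∈ S) ∧ Ideal.span (Set.range k) = Ideal.span S := by
  obtain ⟨T, hTS, hT⟩ := (Submodule.fg_span_iff_fg_span_finset_subset S).1
    (IsNoetherian.noetherian (Ideal.span S))
  refine ⟨T.card, fun i => T.equivFin.symm i, fun i => hTS (T.equivFin.symm i).2, ?_⟩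
  have hrange : Set.range (fun i => (T.equivFin.symm i : R)) = T := by
    rw [Set.range_comp' Subtype.val, T.equivFin.symm.surjective.range_eq]
    simp
  rw [hrange]
  exact hT.symm

theorem span_image_weightSubst (p q : ℕ) (S : Set Poly) :
    Ideal.span (weightSubst p q '' S) = (Ideal.span S).map
      (MvPolynomial.aeval ![(MvPolynomial.X 0 : Poly) ^ q, (MvPolynomial.X 1 : Poly) ^ p]) :=
  (Ideal.map_span _ S).symm

variable {p q N W d : ℕ} {S : Set Poly} {g : Poly}

/-- The homogeneous polynomials `k` of degree `d` with `g * k(x ^ q, y ^ p)` in the ideal `K`.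
For an initial ideal `K` and its greatest common divisor `g`, they generate the ideal
`(k₁, …, kₛ)` of `HasFaceData`. -/
def cofactors (K : Ideal Poly) (p q : ℕ) (g : Poly) (d : ℕ) : Set Poly :=
  {k | k.IsHomogeneous d ∧ g * weightSubst p q k ∈ K}

theorem span_eq_span_mul_cofactors (hp : 0 < p) (hq : 0 < q) (hpq : Nat.Coprime p q)
    (hS : ∀ f ∈ S, MvPolynomial.IsWeightedHomogeneous ![p, q] f (W + p * q * d)) (hg₀ : g ≠ 0)
    (hg : g.IsWeightedHomogeneous ![p, q] W) (hSg : Ideal.span S ≤ Ideal.span {g}) :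
    Ideal.span S = Ideal.span {g} *
      Ideal.span (weightSubst p q '' cofactors (Ideal.span S) p q g d) := by
  refine le_antisymm (Ideal.span_le.2 fun f hf => ?_) ?_
  · have hfS : f ∈ Ideal.span S := Ideal.subset_span hf
    obtain ⟨m, rfl⟩ := Ideal.mem_span_singleton.1 (hSg hfS)
    obtain ⟨k, hk, rfl⟩ := exists_weightSubst_eq hp hq hpq
      (isWeightedHomogeneous_of_mul_left hg₀ hg (hS _ hf))
    exact Ideal.mul_mem_mul (Ideal.mem_span_singleton_self g)
      (Ideal.subset_span ⟨k, ⟨hk, hfS⟩, rfl⟩)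
  · rw [Ideal.span_mul_span', Ideal.span_le]
    rintro _ ⟨_, rfl, _, ⟨k, hk, rfl⟩, rfl⟩
    exact hk.2

theorem weight_eq_of_span_eq_span_mul {s : ℕ} {k : Fin s → Poly} (hp : 0 < p) (hq : 0 < q)
    (hS : ∀ f ∈ S, MvPolynomial.IsWeightedHomogeneous ![p, q] f N) (hg₀ : g ≠ 0)
    (hg : g.IsWeightedHomogeneous ![p, q] W) (hk : ∀ i, (k i).IsHomogeneous d)
    (hk₀ : ∃ i, k i ≠ 0) (hSk : Ideal.span S =
      Ideal.span {g} * Ideal.span (Set.range fun i => weightSubst p q (k i))) :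
    N = W + p * q * d := by
  obtain ⟨i, hi⟩ := hk₀
  have hgk (j) : (g * weightSubst p q (k j)).IsWeightedHomogeneous ![p, q] (W + p * q * d) :=
    hg.mul (isWeightedHomogeneous_weightSubst p q (hk j))
  have hgi₀ : g * weightSubst p q (k i) ≠ 0 := mul_ne_zero hg₀ (weightSubst_ne_zero hp hq hi)
  have hgi : g * weightSubst p q (k i) ∈ Ideal.span S := by
    rw [hSk]
    exact Ideal.mul_mem_mul (Ideal.mem_span_singleton_self g) (Ideal.subset_span ⟨i, rfl⟩)
  refine le_antisymm (le_of_mem_span_of_isWeightedHomogeneous hS hgi₀ (hgk i) hgi) ?_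
  obtain ⟨f, hf, hf₀⟩ : ∃ f ∈ S, f ≠ 0 := by
    by_contra! h
    rw [Ideal.span_eq_bot.2 h] at hgi
    exact hgi₀ hgi
  have hfk : f ∈ Ideal.span {g} * Ideal.span (Set.range fun i => weightSubst p q (k i)) :=
    hSk ▸ Ideal.subset_span hf
  rw [Ideal.span_mul_span'] at hfk
  refine le_of_mem_span_of_isWeightedHomogeneous ?_ hf₀ (hS f hf) hfk
  rintro _ ⟨_, rfl, _, ⟨j, rfl⟩, rfl⟩
  exact hgk j

theorem exists_span_eq_span_mul_iff (hp : 0 < p) (hq : 0 < q) (hpq : Nat.Coprime p q)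
    (hS : ∀ f ∈ S, MvPolynomial.IsWeightedHomogeneous ![p, q] f N) (hg₀ : g ≠ 0)
    (hg : g.IsWeightedHomogeneous ![p, q] W) :
    (∃ (s : ℕ) (k : Fin s → Poly), (∀ i, (k i).IsHomogeneous d) ∧
      (∀ h : Poly, (∀ i, h ∣ k i) → IsUnit h) ∧ Ideal.span S =
        Ideal.span {g} * Ideal.span (Set.range fun i => weightSubst p q (k i))) ↔
    N = W + p * q * d ∧ Ideal.span S ≤ Ideal.span {g} ∧
      ∀ h, Ideal.span S ≤ Ideal.span {g * weightSubst p q h} → IsUnit h := by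
  constructor
  · rintro ⟨s, k, hk, hcop, hSk⟩
    have hk₀ : ∃ i, k i ≠ 0 := by
      by_contra! h
      exact not_isUnit_zero (hcop 0 fun i => (h i).symm ▸ dvd_rfl)
    refine ⟨weight_eq_of_span_eq_span_mul hp hq hS hg₀ hg hk hk₀ hSk,
      hSk.trans_le Ideal.mul_le_left, fun h hh => hcop h fun i => ?_⟩
    rw [hSk, Ideal.span_mul_span', Ideal.span_le] at hh
    have hgi : g * weightSubst p q (k i) ∈ Ideal.span {g * weightSubst p q h} :=
      hh (Set.mul_mem_mul rfl ⟨i, rfl⟩)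
    rwa [Ideal.mem_span_singleton, mul_dvd_mul_iff_left hg₀,
      weightSubst_dvd_weightSubst_iff hp hq] at hgi
  · rintro ⟨rfl, hSg, hcop⟩
    obtain ⟨s, k, hk, hspan⟩ := exists_fin_family_span_eq (cofactors (Ideal.span S) p q g d)
    have hSk : Ideal.span S =
        Ideal.span {g} * Ideal.span (Set.range fun i => weightSubst p q (k i)) := by
      rw [Set.range_comp' (weightSubst p q) k, span_image_weightSubst, hspan,
        ← span_image_weightSubst]
      exact span_eq_span_mul_cofactors hp hq hpq hS hg₀ hg hSg
    refine ⟨s, k, fun i => (hk i).1, fun h hh => hcop h ?_, hSk⟩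
    rw [hSk, ← Ideal.span_singleton_mul_span_singleton]
    refine Ideal.mul_mono_right (Ideal.span_le.2 ?_)
    rintro _ ⟨i, rfl⟩
    exact Ideal.mem_span_singleton.2 ((weightSubst_dvd_weightSubst_iff hp hq).2 (hh i))

theorem isWeightedHomogeneous_monomial_mul_weightSubst (p q a b : ℕ) {F : Poly} {n : ℕ}
    (hF : F.IsHomogeneous n) :
    (MvPolynomial.X 0 ^ a * MvPolynomial.X 1 ^ b * weightSubst p q F).IsWeightedHomogeneous
      ![p, q] (a * p + b * q + p * q * n) := by
  have hx := (MvPolynomial.isWeightedHomogeneous_X ℂ ![p, q] 0).pow a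
  have hy := (MvPolynomial.isWeightedHomogeneous_X ℂ ![p, q] 1).pow b
  exact (hx.mul hy).mul (isWeightedHomogeneous_weightSubst p q hF)

theorem isWeightedHomogeneous_initialPart (hp : 0 < p) (hq : 0 < q) (N : ℕ) (f : Series) :
    (initialPart p q N f).IsWeightedHomogeneous ![p, q] N := by
  intro e he
  by_contra hN
  exact he (by rw [coeff_initialPart hp hq, if_neg hN])

theorem IsReduction.hasFaceData_iff {I J : Ideal Series} (hIJ : IsReduction I J) (hp : 0 < p)
    (hq : 0 < q) (hpq : Nat.Coprime p q) (h : WeightGE I p q N) (F : Poly) (d : ℕ) :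
    HasFaceData J p q N F d ↔ HasFaceData I p q N F d := by
  have hred := hIJ.isReduction_initialIdeal hp hq h
  refine and_congr_right ?_
  rintro ⟨n, hF, -⟩
  refine and_congr_right fun hxF => and_congr_right fun _ =>
    exists_congr fun a => exists_congr fun b => ?_
  have hg₀ : (MvPolynomial.X 0 ^ a * MvPolynomial.X 1 ^ b * weightSubst p q F : Poly) ≠ 0 :=
    mul_ne_zero (mul_ne_zero (pow_ne_zero a (MvPolynomial.X_ne_zero 0))
      (pow_ne_zero b (MvPolynomial.X_ne_zero 1)))
      (weightSubst_ne_zero hp hq fun hF₀ => hxF (hF₀ ▸ dvd_zero _))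
  have hg := isWeightedHomogeneous_monomial_mul_weightSubst p q a b hF
  have hS (K : Ideal Series) : ∀ g ∈ {g | ∃ f ∈ K, g = initialPart p q N f},
      MvPolynomial.IsWeightedHomogeneous ![p, q] g N := by
    rintro _ ⟨f, -, rfl⟩
    exact isWeightedHomogeneous_initialPart hp hq N f
  refine (exists_span_eq_span_mul_iff hp hq hpq (hS J) hg₀ hg).trans
    (Iff.trans ?_ (exists_span_eq_span_mul_iff hp hq hpq (hS I) hg₀ hg).symm)
  change _ ∧ initialIdeal J p q N ≤ _ ∧ (∀ h, initialIdeal J p q N ≤ _ → _) ↔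
    _ ∧ initialIdeal I p q N ≤ _ ∧ (∀ h, initialIdeal I p q N ≤ _ → _)
  simp only [hred.le_iff (.span_singleton _)]

end FaceData

/-! ### The Newton process of a reduction -/

section NewtonProcess

variable {I J : Ideal Series}

theorem IsReduction.isFace_and_hasFaceData_iff (hIJ : IsReduction I J) {p q N : ℕ} {F : Poly}
    {d : ℕ} : IsFace J p q N ∧ HasFaceData J p q N F d ↔
      IsFace I p q N ∧ HasFaceData I p q N F d := by
  rw [hIJ.isFace_iff]
  refine and_congr_right fun hface => ?_
  obtain ⟨hp, hq, hpq, h, -⟩ := isFace_iff_contactSet_nontrivial.1 hface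
  exact hIJ.hasFaceData_iff hp hq hpq h F d

theorem IsReduction.isRootMap_iff (hIJ : IsReduction I J) (σ : NewtonMap) :
    IsRootMap J σ ↔ IsRootMap I σ := by
  simp only [IsRootMap, ← and_assoc, hIJ.isFace_and_hasFaceData_iff]

theorem IsReduction.mapIdeal (hIJ : IsReduction I J) (σ : NewtonMap) :
    IsReduction (σ.mapIdeal I) (σ.mapIdeal J) :=
  hIJ.map (σ.hom : Series →+* Series)

theorem IsReduction.transform (hIJ : IsReduction I J) (L : List NewtonMap) :
    IsReduction (transform I L) (transform J L) := by
  induction L generalizing I J with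
  | nil => exact hIJ
  | cons σ L ih => exact ih (hIJ.mapIdeal σ)

theorem IsReduction.inAlgorithm_iff (hIJ : IsReduction I J) (L : List NewtonMap) :
    InAlgorithm J L ↔ InAlgorithm I L := by
  induction L generalizing I J with
  | nil => exact Iff.rfl
  | cons σ L ih =>
    simp only [InAlgorithm, hIJ.depthZero_iff, hIJ.isRootMap_iff, ih (hIJ.mapIdeal σ)]

theorem IsReduction.inProcess_iff (hIJ : IsReduction I J) (e : ProcessElement) :
    InProcess J e ↔ InProcess I e := by
  cases e with
  | dicritical L p q d =>
    have h := hIJ.transform L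
    simp only [InProcess, hIJ.inAlgorithm_iff, h.depthZero_iff, h.isFace_and_hasFaceData_iff]
  | branch L y ν =>
    have h := hIJ.transform L
    simp only [InProcess, hIJ.inAlgorithm_iff, h.depthZero_iff, h.isGeneratedBy_iff, h.yOrder_eq]

theorem IsReduction.newtonProcess_eq (hIJ : IsReduction I J) :
    newtonProcess J = newtonProcess I := by
  simp only [newtonProcess, hIJ.xOrder_eq, hIJ.inProcess_iff]

end NewtonProcess

end NewtonAlg

theorem mainTheorem6 (I : Ideal NewtonAlg.Series) (hI : I ≠ ⊥) :
    NewtonAlg.newtonProcess (NewtonAlg.integralClosure I) = NewtonAlg.newtonProcess I :=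
  (NewtonAlg.isReduction_integralClosure I).newtonProcess_eq
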